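/- For integers $c_1,\dots,c_k$ (with $k\ge 1$) let $$P(x)=((\cdots((x^2-c_1)^2-c_2)^2\cdots)^2-c_{k-1})^2-c_k\in\mathbb{Z}[x]$$ be the square chain of length $k$ with coefficients $c_1,\dots,c_k$. Suppose that $P$ crumbles over $\mathbb{Z}$, i.e. that $P$ is a product of (not necessarily distinct) linear polynomials in $\mathbb{Z}[x]$. For a positive integer $m$ write $m\#=\prod_{p\le m,\ p\text{ prime}}p$ for the primorial of $m$. Then $2^{j-1}\#$ divides $c_j$ for every $1\le j\le k$. If in addition $c_k\ne 0$, then $c_j>0$ for every $1\le j\le k$, and $\ln c_j>2^{j-2}$ for every $j$ with $5\le j\le k$. -/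

import Mathlib

open Polynomial

/-- The square chain `(⋯((x² - c₁)² - c₂)²⋯)² - cₖ` of length `k` with coefficients
`c 1, …, c k`; the values of `c` outside `1, …, k` are not used. -/
noncomputable def squareChain {D : Type*} [CommRing D] (c : ℕ → D) : ℕ → D[X]
  | 0 => X
  | k + 1 => squareChain c k ^ 2 - C (c (k + 1))

/-- A polynomial crumbles over `D` if it is a product of (not necessarily distinct)
linear polynomials, that is, polynomials of degree one, in `D[X]`. -/
def Crumbles {D : Type*} [CommRing D] (P : D[X]) : Prop :=
  ∃ s : Multiset D[X], (∀ q ∈ s, q.degree = 1) ∧ P = s.prod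

/-! Write P_j for the chain of length j. A root of P_{j+1} - b gives a with a² = c_{j+1} + b, and
P_{j+1} - b = (P_j - a)(P_j + a). Descending from b = 0 at length k, both P_j - b and P_j + b split
at every level. Modulo an odd prime p ∤ a, P_j - a and P_j + a are coprime, and each divides X^p - X
times their common derivative; comparing degrees gives 2^j < p. So primes up to 2^j divide a, hence
also c_{j+1} = a² - b. For size, splitting at -b makes c_{j+1} - b a square, so 2c_{j+1} ≥ c_{j+1} +
b = a², and a is a nonzero multiple of a primorial. Chebyshev's bound finishes. -/

/-- A polynomial that is a product of monic linear factors divides the product of its derivative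
with any common multiple of all linear factors. -/
theorem prod_X_sub_C_dvd_mul_derivative {D : Type*} [CommRing D] {L : D[X]}
    (hL : ∀ t : D, X - C t ∣ L) (s : Multiset D) :
    (s.map fun t => X - C t).prod ∣ L * derivative (s.map fun t => X - C t).prod := by
  induction s using Multiset.induction with
  | empty => simp
  | cons t s ih =>
    simp only [Multiset.map_cons, Multiset.prod_cons, derivative_mul, derivative_X_sub_C, one_mul]
    rw [mul_add]
    refine dvd_add (mul_dvd_mul_right (hL t) _) ?_
    rw [mul_left_comm]
    exact mul_dvd_mul_left _ ih

/-- Two split monic polynomials over `ZMod p` that differ by a nonzero constant have degree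
less than `p`, unless the degree is a multiple of `p`. -/
theorem natDegree_lt_of_splits_of_splits_add_C {p : ℕ} [Fact p.Prime] {f : (ZMod p)[X]}
    {d : ZMod p} (hm : f.Monic) (hf : f.Splits) (hg : (f + C d).Splits) (hd : d ≠ 0)
    (hn : (f.natDegree : ZMod p) ≠ 0) : f.natDegree < p := by
  have hp : 1 < p := (Fact.out : p.Prime).one_lt
  have hn0 : f.natDegree ≠ 0 := fun h => hn (by simp [h])
  have hL : ∀ t : ZMod p, X - C t ∣ (X ^ p - X : (ZMod p)[X]) := fun t => by
    rw [dvd_iff_isRoot]; simp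
  have key : ∀ h : (ZMod p)[X], h.Monic → h.Splits → h ∣ (X ^ p - X) * derivative h := by
    intro h hm hs
    have := prod_X_sub_C_dvd_mul_derivative hL h.roots
    rwa [← hs.eq_prod_roots_of_monic hm] at this
  have hdeg : (C d).degree < f.degree := by
    rw [degree_C hd]
    exact natDegree_pos_iff_degree_pos.mp (Nat.pos_of_ne_zero hn0)
  have h1 := key f hm hf
  have h2 := key _ (hm.add_of_left hdeg) hg
  rw [derivative_add, derivative_C, add_zero] at h2
  have hcop : IsCoprime f (f + C d) := by
    refine ⟨-C d⁻¹, C d⁻¹, ?_⟩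
    have : C d⁻¹ * C d = (1 : (ZMod p)[X]) := by rw [← C_mul, inv_mul_cancel₀ hd, C_1]
    linear_combination this
  have hdvd := hcop.mul_dvd h1 h2
  have hf' : derivative f ≠ 0 := by
    intro h
    have hc := congrArg (fun q => q.coeff (f.natDegree - 1)) h
    simp only [coeff_derivative, coeff_zero] at hc
    rw [← Nat.cast_add_one, Nat.sub_add_cancel (Nat.pos_of_ne_zero hn0), hm.coeff_natDegree,
      one_mul] at hc
    exact hn hc
  have hL0 : (X ^ p - X : (ZMod p)[X]) ≠ 0 := FiniteField.X_pow_card_sub_X_ne_zero _ hp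
  -- With n = deg f, this reads 2n ≤ p + deg f' < p + n.
  have hle := natDegree_le_of_dvd hdvd (mul_ne_zero hL0 hf')
  rw [natDegree_mul hm.ne_zero (hm.add_of_left hdeg).ne_zero, natDegree_mul hL0 hf',
    FiniteField.X_pow_card_sub_X_natDegree_eq _ hp, natDegree_add_C] at hle
  have := natDegree_derivative_lt hn0
  omega

theorem squareChain_monic_and_natDegree {D : Type*} [CommRing D] [Nontrivial D] (c : ℕ → D)
    (k : ℕ) : (squareChain c k).Monic ∧ (squareChain c k).natDegree = 2 ^ k := by
  induction k with
  | zero => simp [squareChain, monic_X]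
  | succ k ih =>
    obtain ⟨hm, hd⟩ := ih
    have hd2 : (squareChain c k ^ 2).natDegree = 2 ^ (k + 1) := by
      rw [hm.natDegree_pow, hd, pow_succ, mul_comm]
    refine ⟨(hm.pow 2).sub_of_left (degree_C_le.trans_lt ?_), ?_⟩
    · exact natDegree_pos_iff_degree_pos.mp (by rw [hd2]; positivity)
    · rw [squareChain, natDegree_sub_C, hd2]

theorem squareChain_sub_C_monic {D : Type*} [CommRing D] [Nontrivial D] (c : ℕ → D)
    (k : ℕ) (b : D) : (squareChain c k - C b).Monic := by
  obtain ⟨hm, hd⟩ := squareChain_monic_and_natDegree c k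
  exact hm.sub_of_left (degree_C_le.trans_lt
    (natDegree_pos_iff_degree_pos.mp (by rw [hd]; positivity)))

/-- A monic polynomial that crumbles over the integers splits. -/
theorem Crumbles.splits {P : ℤ[X]} (hP : Crumbles P) (hm : P.Monic) : P.Splits := by
  obtain ⟨s, hs, rfl⟩ := hP
  refine Splits.multisetProd fun q hq => ?_
  have hu : IsUnit q.leadingCoeff := by
    have : q.leadingCoeff ∣ s.prod.leadingCoeff := by
      obtain ⟨r, hr⟩ := Multiset.dvd_prod hq
      exact ⟨r.leadingCoeff, by rw [hr, leadingCoeff_mul]⟩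
    rw [hm.leadingCoeff] at this
    exact isUnit_of_dvd_one this
  rcases Int.isUnit_iff.mp hu with h | h
  · exact Splits.of_degree_le_one_of_monic (hs q hq).le h
  · rw [← splits_neg_iff]
    refine Splits.of_degree_le_one_of_monic (by rw [degree_neg]; exact (hs q hq).le) ?_
    rw [Monic, leadingCoeff_neg, h, neg_neg]

/-- If a shift of a square chain over the integers splits, its last coefficient is a shifted
square and the chain shortened by one step splits after a shift by either square root. -/
theorem exists_sq_of_splits_squareChain_succ {c : ℕ → ℤ} {j : ℕ} {b : ℤ}
    (h : (squareChain c (j + 1) - C b).Splits) :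
    ∃ a : ℤ, a ^ 2 = c (j + 1) + b ∧ ∀ e : ℤ, e ^ 2 = a ^ 2 → (squareChain c j - C e).Splits := by
  have hdeg : (squareChain c (j + 1) - C b).degree ≠ 0 := by
    refine (natDegree_pos_iff_degree_pos.mp ?_).ne'
    rw [natDegree_sub_C, (squareChain_monic_and_natDegree c _).2]
    positivity
  obtain ⟨r, hr⟩ := h.exists_eval_eq_zero hdeg
  have ha : (squareChain c j).eval r ^ 2 = c (j + 1) + b := by
    simp only [squareChain, eval_sub, eval_pow, eval_C] at hr
    linarith
  refine ⟨_, ha, fun e he => h.of_dvd (squareChain_sub_C_monic c _ b).ne_zero ?_⟩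
  refine ⟨squareChain c j + C e, ?_⟩
  have : C e ^ 2 = C (c (j + 1)) + C b := by rw [← C_pow, he, ha, C_add]
  simp only [squareChain]
  linear_combination this

/-- If both shifts of a square chain of length `j` by `a` and `-a` split over the integers, then
`a` is divisible by every prime up to `2 ^ j`. -/
theorem prime_dvd_of_splits_squareChain_sub_C {c : ℕ → ℤ} {j : ℕ} {a : ℤ}
    (h1 : (squareChain c j - C a).Splits) (h2 : (squareChain c j - C (-a)).Splits)
    {p : ℕ} (hp : p.Prime) (hpj : p ≤ 2 ^ j) : (p : ℤ) ∣ a := by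
  rcases hp.eq_two_or_odd' with rfl | hodd
  · obtain _ | i := j
    · simp at hpj
    obtain ⟨y, hy, -⟩ := exists_sq_of_splits_squareChain_succ h1
    obtain ⟨z, hz, -⟩ := exists_sq_of_splits_squareChain_succ h2
    -- The two factors have the same parity, so their even product is divisible by 4.
    have hyz : (y - z) * (y + z) = 2 * a := by linear_combination hy - hz
    have hev : Even ((y - z) * (y + z)) := by rw [hyz]; exact even_two_mul a
    rw [Nat.cast_ofNat]
    rcases Int.even_mul.mp hev with h | h
    · obtain ⟨u, hu⟩ := h
      obtain rfl : y = z + 2 * u := by linarith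
      exact ⟨u * (u + z), by linarith⟩
    · obtain ⟨u, hu⟩ := h
      obtain rfl : y = 2 * u - z := by linarith
      exact ⟨u * (u - z), by linarith⟩
  · have := Fact.mk hp
    by_contra hpa
    have ha : (a : ZMod p) ≠ 0 := by rwa [Ne, ZMod.intCast_zmod_eq_zero_iff_dvd]
    have h2ne : (2 : ZMod p) ≠ 0 := by
      intro h
      have : p ∣ 2 := (ZMod.natCast_eq_zero_iff 2 p).mp (by exact_mod_cast h)
      rw [(Nat.prime_dvd_prime_iff_eq hp Nat.prime_two).mp this] at hodd
      exact absurd hodd (by decide)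
    have h1' := h1.map (Int.castRingHom (ZMod p))
    have h2' := h2.map (Int.castRingHom (ZMod p))
    have hshift : (squareChain c j - C (-a)).map (Int.castRingHom (ZMod p)) =
        (squareChain c j - C a).map (Int.castRingHom (ZMod p)) + C (2 * (a : ZMod p)) := by
      rw [Polynomial.map_sub, Polynomial.map_sub, Polynomial.map_C, Polynomial.map_C, map_neg,
        eq_intCast, C_neg, C_mul]
      rw [show (C 2 : (ZMod p)[X]) = 2 from rfl]
      ring
    rw [hshift] at h2'
    have hm := (squareChain_sub_C_monic c j a).map (Int.castRingHom (ZMod p))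
    have hd : ((squareChain c j - C a).map (Int.castRingHom (ZMod p))).natDegree = 2 ^ j := by
      rw [(squareChain_sub_C_monic c j a).natDegree_map, natDegree_sub_C,
        (squareChain_monic_and_natDegree c j).2]
    have hlt := natDegree_lt_of_splits_of_splits_add_C hm h1' h2' (mul_ne_zero h2ne ha)
      (by rw [hd]; push_cast; exact pow_ne_zero _ h2ne)
    omega

/-- An integer divisible by every prime up to `n` is divisible by the primorial of `n`. -/
theorem primorial_dvd_of_forall_prime_dvd {n : ℕ} {a : ℤ}
    (h : ∀ p : ℕ, p.Prime → p ≤ n → (p : ℤ) ∣ a) : (primorial n : ℤ) ∣ a := by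
  rw [Int.natCast_dvd]
  refine Finset.prod_primes_dvd _ (fun p hp => ?_) (fun p hp => ?_)
  · exact (Finset.mem_filter.mp hp).2.prime
  · obtain ⟨h1, h2⟩ := Finset.mem_filter.mp hp
    rw [← Int.natCast_dvd]
    exact h p h2 (by simpa [Nat.lt_succ_iff] using h1)

theorem primorial_dvd_of_splits_squareChain_sub_C {c : ℕ → ℤ} {j : ℕ} {a : ℤ}
    (h1 : (squareChain c j - C a).Splits) (h2 : (squareChain c j - C (-a)).Splits) :
    (primorial (2 ^ j) : ℤ) ∣ a :=
  primorial_dvd_of_forall_prime_dvd fun _ hp hpj =>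
    prime_dvd_of_splits_squareChain_sub_C h1 h2 hp hpj

/-- If a square chain of length `k` splits over the integers, then for every `j ≤ k` the shifts of
the chain of length `j` by `b` and `-b` split, for some `b ≥ 0` that is positive if `j < k` and
the last coefficient is nonzero. -/
theorem exists_splits_squareChain_sub_C {c : ℕ → ℤ} {k j : ℕ} (h : (squareChain c k).Splits)
    (hj : j ≤ k) : ∃ b : ℤ, 0 ≤ b ∧ (squareChain c j - C b).Splits ∧
      (squareChain c j - C (-b)).Splits ∧ (c k ≠ 0 → j < k → 0 < b) := by
  induction hj using Nat.decreasingInduction with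
  | self => exact ⟨0, le_rfl, by simpa using h, by simpa using h, by simp⟩
  | of_succ i hi ih =>
    obtain ⟨b, hb0, hb1, hb2, hb3⟩ := ih
    obtain ⟨a, ha, hs⟩ := exists_sq_of_splits_squareChain_succ hb1
    obtain ⟨z, hz, -⟩ := exists_sq_of_splits_squareChain_succ hb2
    refine ⟨|a|, abs_nonneg a, hs _ (sq_abs a), hs _ (by rw [neg_sq, sq_abs]), fun hck _ => ?_⟩
    rw [abs_pos]
    rintro rfl
    rcases (show i + 1 ≤ k from hi).lt_or_eq with hlt | rfl
    -- If a = 0, then c (i + 1) = -b and z² = -2b < 0.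
    · nlinarith [hb3 hck hlt, sq_nonneg z]
    · apply hck
      nlinarith [sq_nonneg z]

theorem primorial_dvd_of_splits_squareChain {c : ℕ → ℤ} {k j : ℕ} (h : (squareChain c k).Splits)
    (hj : j + 1 ≤ k) : (primorial (2 ^ j) : ℤ) ∣ c (j + 1) := by
  obtain ⟨b, -, hb1, hb2, -⟩ := exists_splits_squareChain_sub_C h hj
  obtain ⟨a, ha, hs⟩ := exists_sq_of_splits_squareChain_succ hb1
  have hpa := primorial_dvd_of_splits_squareChain_sub_C (hs a rfl) (hs (-a) (neg_sq a))
  have hpb := primorial_dvd_of_splits_squareChain_sub_C hb1 hb2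
  have hpb' : (primorial (2 ^ j) : ℤ) ∣ b :=
    (Int.natCast_dvd_natCast.mpr (primorial_dvd_primorial
      (Nat.pow_le_pow_right two_pos j.le_succ))).trans hpb
  rw [show c (j + 1) = a ^ 2 - b by rw [ha]; ring]
  exact dvd_sub (dvd_pow hpa two_ne_zero) hpb'

/-- The coefficients of a split square chain with nonzero last coefficient are at least half the
square of a primorial. -/
theorem primorial_sq_le_of_splits_squareChain {c : ℕ → ℤ} {k j : ℕ} (h : (squareChain c k).Splits)
    (hck : c k ≠ 0) (hj : j + 1 ≤ k) : (primorial (2 ^ j) : ℤ) ^ 2 ≤ 2 * c (j + 1) := by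
  obtain ⟨b, hb0, hb1, hb2, hb3⟩ := exists_splits_squareChain_sub_C h hj
  obtain ⟨a, ha, hs⟩ := exists_sq_of_splits_squareChain_succ hb1
  obtain ⟨z, hz, -⟩ := exists_sq_of_splits_squareChain_succ hb2
  have hpa := primorial_dvd_of_splits_squareChain_sub_C (hs a rfl) (hs (-a) (neg_sq a))
  have hbc : b ≤ c (j + 1) := by nlinarith [sq_nonneg z]
  have ha0 : 0 < a ^ 2 := by
    rcases hj.lt_or_eq with hlt | rfl
    · linarith [hb3 hck hlt]
    · have : 0 < c (j + 1) := lt_of_le_of_ne (hb0.trans hbc) (Ne.symm hck)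
      linarith
  have := Int.le_of_dvd ha0 (pow_dvd_pow_of_dvd hpa 2)
  linarith

/-- The constants here and in `succ_mul_le_two_pow` give equality at m = 10. -/
theorem sq_mul_le_two_pow {m : ℕ} (hm : 10 ≤ m) : 1024 * m ^ 2 ≤ 100 * 2 ^ m := by
  induction m, hm using Nat.le_induction with
  | base => norm_num
  | succ m hm ih => rw [pow_succ 2 m]; nlinarith

theorem succ_mul_le_two_pow {m : ℕ} (hm : 10 ≤ m) : 1024 * (m + 1) ≤ 11 * 2 ^ m := by
  induction m, hm using Nat.le_induction with
  | base => norm_num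
  | succ m hm ih => rw [pow_succ 2 m]; omega

/-- A weak form of Chebyshev's bound for the primorial of a power of two, with no small
exceptions. -/
theorem two_pow_lt_log_primorial {m : ℕ} (hm : 4 ≤ m) :
    (2 : ℝ) ^ m / 2 + Real.log 2 < 2 * Real.log (primorial (2 ^ m)) := by
  have hl := Real.log_two_gt_d9
  have hl' := Real.log_two_lt_d9
  rcases lt_or_ge m 10 with hlt | hge
  -- A finite check: 0.69 is a lower bound for log 2, and the added 1 absorbs the log 2 term.
  · have small : ∀ n e : ℕ, n ≤ 2 ^ m → 2 ^ e ≤ primorial n → 2 ^ m / 4 + 1 ≤ (0.69 : ℝ) * e →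
        (2 : ℝ) ^ m / 2 + Real.log 2 < 2 * Real.log (primorial (2 ^ m)) := by
      intro n e hn he hme
      have h1 : ((2 ^ e : ℕ) : ℝ) ≤ (primorial (2 ^ m) : ℝ) :=
        Nat.cast_le.mpr (he.trans (primorial_mono hn))
      have h2 := Real.log_le_log (by positivity) h1
      rw [Nat.cast_pow, Real.log_pow, Nat.cast_ofNat] at h2
      nlinarith [(Nat.cast_nonneg e : (0 : ℝ) ≤ e)]
    interval_cases m
    · exact small 16 14 (by norm_num) (by decide +kernel) (by norm_num)
    · exact small 16 14 (by norm_num) (by decide +kernel) (by norm_num)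
    · exact small 32 25 (by norm_num) (by decide +kernel) (by norm_num)
    · exact small 64 48 (by norm_num) (by decide +kernel) (by norm_num)
    · exact small 128 95 (by norm_num) (by decide +kernel) (by norm_num)
    · exact small 160 187 (by norm_num) (by decide +kernel) (by norm_num)
  · have hs2 : √(2 ^ m : ℝ) ^ 2 = 2 ^ m := Real.sq_sqrt (by positivity)
    have hs0 : 0 ≤ √(2 ^ m : ℝ) := Real.sqrt_nonneg _
    have h1 : (1024 : ℝ) * m ^ 2 ≤ 100 * 2 ^ m := by exact_mod_cast sq_mul_le_two_pow hge
    have h2 : (1024 : ℝ) * (m + 1) ≤ 11 * 2 ^ m := by exact_mod_cast succ_mul_le_two_pow hge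
    have h3 : (1024 : ℝ) ≤ 2 ^ m := by
      exact_mod_cast (Nat.pow_le_pow_right two_pos hge : 2 ^ 10 ≤ 2 ^ m)
    have hms : 32 * (m : ℝ) ≤ 10 * √(2 ^ m : ℝ) :=
      le_of_sq_le_sq (by rw [mul_pow, mul_pow, hs2]; linarith) (by positivity)
    have hθ := Chebyshev.theta_ge (2 ^ m)
    rw [Chebyshev.theta_eq_log_primorial, Nat.floor_natCast] at hθ
    push_cast at hθ
    rw [Real.log_pow] at hθ
    have hlog : Real.log (2 ^ m + 1) ≤ (m + 1) * Real.log 2 := by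
      have : (2 : ℝ) ^ m + 1 ≤ 2 ^ (m + 1) := by rw [pow_succ]; linarith
      have := Real.log_le_log (by positivity) this
      rw [Real.log_pow] at this
      exact_mod_cast this
    have hprod : √(2 ^ m : ℝ) * m ≤ 10 / 32 * 2 ^ m := by nlinarith
    -- 1 - 11/1024 - 20/32 > 0.364, and 2 · 0.364 · log 2 > 1/2.
    have hfin : (0.364 : ℝ) * 2 ^ m ≤ 2 ^ m - (m + 1) - 2 * (√(2 ^ m : ℝ) * m) := by linarith
    have : (0.364 : ℝ) * 2 ^ m * Real.log 2 ≤
        (2 ^ m - (m + 1) - 2 * (√(2 ^ m : ℝ) * m)) * Real.log 2 := by gcongr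
    nlinarith

theorem proposition2 (k : ℕ) (c : ℕ → ℤ) (hP : Crumbles (squareChain c k)) :
    (∀ j : ℕ, 1 ≤ j → j ≤ k → (primorial (2 ^ (j - 1)) : ℤ) ∣ c j) ∧
    (c k ≠ 0 →
      (∀ j : ℕ, 1 ≤ j → j ≤ k → 0 < c j) ∧
      (∀ j : ℕ, 5 ≤ j → j ≤ k → (2 : ℝ) ^ (j - 2) < Real.log (c j : ℝ))) := by
  have hS := hP.splits (squareChain_monic_and_natDegree c k).1
  have hpos : ∀ j : ℕ, 0 < (primorial (2 ^ j) : ℤ) := fun j => by exact_mod_cast primorial_pos _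
  refine ⟨fun j h1 hj => ?_, fun hck => ⟨fun j h1 hj => ?_, fun j h5 hj => ?_⟩⟩
  · obtain ⟨i, rfl⟩ := Nat.exists_eq_add_of_le' h1
    exact primorial_dvd_of_splits_squareChain hS hj
  · obtain ⟨i, rfl⟩ := Nat.exists_eq_add_of_le' h1
    have := primorial_sq_le_of_splits_squareChain hS hck hj
    have := pow_pos (hpos i) 2
    linarith
  · obtain ⟨i, rfl⟩ := Nat.exists_eq_add_of_le' h5
    have hle := primorial_sq_le_of_splits_squareChain hS hck hj
    have hp0 : (0 : ℝ) < primorial (2 ^ (i + 4)) := by exact_mod_cast primorial_pos _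
    have hle' : (primorial (2 ^ (i + 4)) : ℝ) ^ 2 / 2 ≤ (c (i + 5) : ℝ) := by
      rw [div_le_iff₀ two_pos, mul_comm]; exact_mod_cast hle
    have hlog := Real.log_le_log (by positivity) hle'
    rw [Real.log_div (by positivity) two_ne_zero, Real.log_pow, Nat.cast_ofNat] at hlog
    have hch := two_pow_lt_log_primorial (m := i + 4) (by omega)
    have hpow : (2 : ℝ) ^ (i + 5 - 2) = 2 ^ (i + 4) / 2 := by
      rw [show i + 5 - 2 = i + 3 by omega, pow_succ 2 (i + 3)]; ring
    rw [hpow]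
    linarith
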